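/- Let $n\ge 4$ be an integer and let $K$ be a field that contains a primitive $2^{n-2}$-th root of unity $\zeta=\zeta_{2^{n-2}}$ but no primitive $2^{n-1}$-th root of unity. Let $q$ be a non-degenerate quadratic form over $K$ on a $K$-vector space of dimension $2^n$. Then the following are equivalent: (a) $q$ is Witt-equivalent to the trace form $q_{L/K}\colon x\mapsto \operatorname{tr}_{L/K}(x^2)$ of some $M(2^n)$-Galois field extension $L/K$, i.e. a finite Galois field extension with $\operatorname{Gal}(L/K)\cong M(2^n)$, where $$M(2^n)=\langle \sigma,\tau \mid \sigma^{2^{n-1}}=1=\tau^2,\ \tau\sigma\tau=\sigma^{1+2^{n-2}}\rangle ;$$ (b) $q$ is Witt-equivalent to the Pfister form $\langle\langle \zeta,a\rangle\rangle=\langle 1,-\zeta\rangle\otimes\langle 1,-a\rangle=\langle 1,-\zeta,-a,\zeta a\rangle$ for some $a\in K^*$ with $[a]\ne[1]$ and $[a]\neq[\zeta]$, where $[x]$ denotes the class of $x$ in $K^*/(K^*)^2$. Here two quadratic forms over $K$ are called Witt-equivalent if they become isometric after adding to each of them an orthogonal sum of finitely many (possibly zero) hyperbolic planes. -/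

import Mathlib

universe u v w

namespace TraceForms

/-- The trace form `q_{L/K} : x ↦ tr_{L/K}(x ^ 2)`. -/
noncomputable def traceQuadraticForm (K : Type u) (L : Type v) [Field K] [Field L] [Algebra K L] :
    QuadraticForm K L :=
  (Algebra.traceForm K L).toQuadraticMap

theorem traceQuadraticForm_apply (K : Type u) (L : Type v) [Field K] [Field L] [Algebra K L]
    (x : L) : traceQuadraticForm K L x = Algebra.trace K L (x ^ 2) := by
  simp [traceQuadraticForm, Algebra.traceForm_apply, sq]

/-- The orthogonal sum of `m` hyperbolic planes: `(x, y) ↦ ∑ i, x i * y i` on `K ^ m × K ^ m`. -/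
def hyperbolicSpace (K : Type u) [Field K] (m : ℕ) :
    QuadraticForm K ((Fin m → K) × (Fin m → K)) :=
  ∑ i : Fin m, QuadraticMap.linMulLin
    ((LinearMap.proj i).comp (LinearMap.fst K (Fin m → K) (Fin m → K)))
    ((LinearMap.proj i).comp (LinearMap.snd K (Fin m → K) (Fin m → K)))

theorem hyperbolicSpace_apply (K : Type u) [Field K] (m : ℕ) (x y : Fin m → K) :
    hyperbolicSpace K m (x, y) = ∑ i, x i * y i := by
  simp [hyperbolicSpace]

/-- Witt equivalence: the two forms become isometric after adding hyperbolic planes to each. -/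
def WittEquivalent {K : Type u} {V : Type v} {W : Type w} [Field K]
    [AddCommGroup V] [Module K V] [AddCommGroup W] [Module K W]
    (q : QuadraticForm K V) (q' : QuadraticForm K W) : Prop :=
  ∃ m m' : ℕ, (q.prod (hyperbolicSpace K m)).Equivalent (q'.prod (hyperbolicSpace K m'))

/-- The `2`-fold Pfister form `⟪a, b⟫ = ⟨1, -a⟩ ⊗ ⟨1, -b⟩ = ⟨1, -a, -b, ab⟩`. -/
def pfisterForm {K : Type u} [Field K] (a b : Kˣ) : QuadraticForm K (Fin 4 → K) :=
  QuadraticMap.weightedSumSquares K ![(1 : K), -(a : K), -(b : K), (a : K) * (b : K)]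

/-- The relators `σ ^ (2 ^ (n - 1))`, `τ ^ 2`, `τ σ τ = σ ^ (1 + 2 ^ (n - 2))`, where
`σ` and `τ` are the generators with index `0` and `1`. Used only for `n ≥ 4`. -/
def modularRelators (n : ℕ) : Set (FreeGroup (Fin 2)) :=
  {FreeGroup.of 0 ^ 2 ^ (n - 1),
   FreeGroup.of 1 ^ 2,
   FreeGroup.of 1 * FreeGroup.of 0 * FreeGroup.of 1 *
     (FreeGroup.of 0 ^ (1 + 2 ^ (n - 2)))⁻¹}

/-- The modular group
`M(2 ^ n) = ⟨σ, τ | σ ^ (2 ^ (n - 1)) = 1 = τ ^ 2, τ σ τ = σ ^ (1 + 2 ^ (n - 2))⟩`. -/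
abbrev ModularTwoGroup (n : ℕ) : Type :=
  PresentedGroup (modularRelators n)

/-- The square class `[a]` of `a` in `Kˣ / (Kˣ) ^ 2`. -/
def squareClass {K : Type u} [Field K] (a : Kˣ) : Kˣ ⧸ Subgroup.square Kˣ :=
  QuotientGroup.mk a

end TraceForms

/-! Put `M = 2 ^ (n - 4)`, so `ζ` has order `4M`, `σ` has order `8M` and `[L : K] = 16M`. The key is
that `σ ^ 2` is central of order `4M`, the order of `ζ`, so `L` splits into eigenspaces of `σ ^ 2`
over `K`. Since the trace of an eigenvector with eigenvalue other than 1 vanishes, the `l`- and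
`m`-eigenspaces are trace-orthogonal unless `l * m = 1`. Eigenvalues `ζ ^ d` and `ζ ^ (-d)` with `0
< d < 2M` therefore pair hyperbolically, the eigenvalue `-1` also gives a hyperbolic space, and only
the fixed field of `σ ^ 2` survives. It is biquadratic, `K(√b, √c)`, and contributes `16M⟨1, b, c,
bc⟩`. As `16M` and `-1` are squares in `K`, this is `⟪b, c⟫` (`wittEquivalent_traceForm`).

From (a) to (b), a Kummer vector for `σ ^ 2` shows that `ζ` is `b` times a norm from `K(√c)`
(`exists_modular_data`), so `⟪b, c⟫ ≅ ⟪ζ, c⟫`. Take `a = c`, or `a = b` if `c` lies in the class of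
`ζ`; the excluded classes are avoided because Galois elements negate `√b`, `√c` and `√(bc)`.

From (b) to (a), adjoin to `K` a square root of `ζ` and an `8M`-th root of `a`. The conditions on
`a` and the absence of a primitive `8M`-th root of unity make the group modular
(`exists_isModularPair`), and here `b = ζ`, `c = a`. -/

namespace TraceForms

/-! ### Witt equivalence and splitting off hyperbolic planes. -/

section Witt

variable {K : Type u} [Field K]

theorem hyperbolicSpace_add_equivalent (m k : ℕ) :
    (hyperbolicSpace K (m + k)).Equivalent
      ((hyperbolicSpace K m).prod (hyperbolicSpace K k)) := by
  refine ⟨⟨⟨⟨⟨fun p => ((fun i => p.1 (Fin.castAdd k i), fun i => p.2 (Fin.castAdd k i)),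
    (fun i => p.1 (Fin.natAdd m i), fun i => p.2 (Fin.natAdd m i))), fun _ _ => rfl⟩,
    fun _ _ => rfl⟩,
    fun p => (Fin.append p.1.1 p.2.1, Fin.append p.1.2 p.2.2), ?_, ?_⟩, ?_⟩⟩
  · rintro ⟨p, r⟩
    ext i <;> refine Fin.addCases (fun i => ?_) (fun i => ?_) i <;> simp
  · rintro ⟨⟨p, r⟩, ⟨p', r'⟩⟩
    simp
  · rintro ⟨p, r⟩
    simp [QuadraticMap.prod_apply, hyperbolicSpace_apply, Fin.sum_univ_add]

variable {V : Type*} {W : Type*} {U : Type*} [AddCommGroup V] [Module K V]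
  [AddCommGroup W] [Module K W] [AddCommGroup U] [Module K U]

theorem prod_assoc_equivalent (q : QuadraticForm K V) (r : QuadraticForm K W)
    (s : QuadraticForm K U) : ((q.prod r).prod s).Equivalent (q.prod (r.prod s)) :=
  ⟨⟨LinearEquiv.prodAssoc K V W U, fun x => by simp [QuadraticMap.prod_apply, add_assoc]⟩⟩

theorem prod_hyperbolicSpace_add (q : QuadraticForm K V) (m k : ℕ) :
    (q.prod (hyperbolicSpace K (m + k))).Equivalent
      ((q.prod (hyperbolicSpace K m)).prod (hyperbolicSpace K k)) :=
  ((QuadraticMap.Equivalent.refl q).prod (hyperbolicSpace_add_equivalent m k)).trans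
    (prod_assoc_equivalent _ _ _).symm

theorem WittEquivalent.symm {q : QuadraticForm K V} {r : QuadraticForm K W}
    (h : WittEquivalent q r) : WittEquivalent r q := by
  obtain ⟨m, m', h⟩ := h
  exact ⟨m', m, h.symm⟩

/-- Enough planes are added on both sides for the two copies of the middle form to carry the same
hyperbolic part, so Witt cancellation is not needed. -/
theorem WittEquivalent.trans {q : QuadraticForm K V} {r : QuadraticForm K W}
    {s : QuadraticForm K U} (h : WittEquivalent q r) (h' : WittEquivalent r s) :
    WittEquivalent q s := by
  obtain ⟨m, m', h⟩ := h
  obtain ⟨k, k', h'⟩ := h'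
  refine ⟨m + k, k' + m', ?_⟩
  have h₁ : ((r.prod (hyperbolicSpace K m')).prod (hyperbolicSpace K k)).Equivalent
      ((r.prod (hyperbolicSpace K k)).prod (hyperbolicSpace K m')) := by
    refine (prod_hyperbolicSpace_add r m' k).symm.trans ?_
    rw [add_comm]
    exact prod_hyperbolicSpace_add r k m'
  exact (prod_hyperbolicSpace_add q m k).trans <|
    (h.prod (.refl _)).trans <| h₁.trans <| (h'.prod (.refl _)).trans <|
      (prod_hyperbolicSpace_add s k' m').symm

theorem WittEquivalent.of_equivalent {q : QuadraticForm K V} {r : QuadraticForm K W}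
    (h : q.Equivalent r) : WittEquivalent q r :=
  ⟨0, 0, h.prod (.refl _)⟩

theorem WittEquivalent.of_equivalent_prod {q : QuadraticForm K V} {r : QuadraticForm K W} {m : ℕ}
    (h : q.Equivalent (r.prod (hyperbolicSpace K m))) : WittEquivalent q r := by
  refine ⟨0, m, ?_⟩
  refine QuadraticMap.Equivalent.trans ?_ h
  let _ : Unique ((Fin 0 → K) × (Fin 0 → K)) := ⟨⟨0⟩, fun _ => Subsingleton.elim _ _⟩
  refine ⟨⟨(LinearEquiv.prodUnique : (V × ((Fin 0 → K) × (Fin 0 → K))) ≃ₗ[K] V), ?_⟩⟩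
  rintro ⟨x, p, r⟩
  simp [QuadraticMap.prod_apply, hyperbolicSpace_apply]

/-- A symmetric bilinear space spanned by an orthogonal family of anisotropic vectors and by two
totally isotropic families in duality is the sum of a diagonal form and hyperbolic planes. -/
theorem wittEquivalent_weightedSumSquares_of_gram [FiniteDimensional K V] {ι κ : Type*}
    [Fintype ι] [Fintype κ] [DecidableEq ι] [DecidableEq κ] (h2 : (2 : K) ≠ 0)
    (B : LinearMap.BilinForm K V) (hB : ∀ a b, B a b = B b a) (f : ι → V) (x y : κ → V)
    (w : ι → K) (hw : ∀ i, w i ≠ 0)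
    (hff : ∀ i j, B (f i) (f j) = if i = j then w i else 0)
    (hfx : ∀ i j, B (f i) (x j) = 0) (hfy : ∀ i j, B (f i) (y j) = 0)
    (hxx : ∀ i j, B (x i) (x j) = 0) (hyy : ∀ i j, B (y i) (y j) = 0)
    (hxy : ∀ i j, B (x i) (y j) = if i = j then 2⁻¹ else 0)
    (hcard : Fintype.card ι + 2 * Fintype.card κ = Module.finrank K V) :
    WittEquivalent B.toQuadraticMap (QuadraticMap.weightedSumSquares K w) := by
  let e := Fintype.equivFin κ
  let T : ((ι → K) × ((Fin (Fintype.card κ) → K) × (Fin (Fintype.card κ) → K))) →ₗ[K] V :=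
    (Fintype.linearCombination K f).coprod
      ((Fintype.linearCombination K (x ∘ e.symm)).coprod
        (Fintype.linearCombination K (y ∘ e.symm)))
  have hT : ∀ a p r, T (a, (p, r)) = (∑ i, a i • f i) + ((∑ i, p i • x (e.symm i)) +
      ∑ i, r i • y (e.symm i)) := by
    intro a p r
    simp [T, Fintype.linearCombination_apply]
  have hxf : ∀ i j, B (x i) (f j) = 0 := fun i j => by rw [hB, hfx]
  have hyf : ∀ i j, B (y i) (f j) = 0 := fun i j => by rw [hB, hfy]
  have hyx : ∀ i j, B (y i) (x j) = if i = j then 2⁻¹ else 0 := fun i j => by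
    rw [hB, hxy]; simp [eq_comm]
  have h1 : ∀ a p r j, B (T (a, (p, r))) (f j) = a j * w j := by
    intro a p r j
    simp [hT, hff, hxf, hyf]
  have h3 : ∀ a p r j, B (T (a, (p, r))) (x j) = r (e j) * 2⁻¹ := by
    intro a p r j
    simp [hT, hfx, hxx, hyx, Equiv.symm_apply_eq]
  have h4 : ∀ a p r j, B (T (a, (p, r))) (y j) = p (e j) * 2⁻¹ := by
    intro a p r j
    simp [hT, hfy, hxy, hyy, Equiv.symm_apply_eq]
  -- Pairing with the `f j`, `y j` and `x j` recovers each coordinate up to a nonzero factor.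
  have hinj : Function.Injective T := by
    rw [← LinearMap.ker_eq_bot, LinearMap.ker_eq_bot']
    rintro ⟨a, p, r⟩ h0
    have h2' : (2 : K)⁻¹ ≠ 0 := inv_ne_zero h2
    have ha : a = 0 := by
      ext j
      have := h1 a p r j
      rw [h0] at this
      simpa [hw j] using this.symm
    have hp : p = 0 := by
      ext j
      have := h4 a p r (e.symm j)
      rw [h0] at this
      simpa [h2] using this.symm
    have hr : r = 0 := by
      ext j
      have := h3 a p r (e.symm j)
      rw [h0] at this
      simpa [h2] using this.symm
    rw [ha, hp, hr]; rfl
  have hdim : Module.finrank K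
      ((ι → K) × ((Fin (Fintype.card κ) → K) × (Fin (Fintype.card κ) → K))) =
      Module.finrank K V := by
    rw [← hcard]; simp; ring
  let E := LinearEquiv.ofBijective T
    ⟨hinj, (LinearMap.injective_iff_surjective_of_finrank_eq_finrank hdim).1 hinj⟩
  refine WittEquivalent.of_equivalent_prod (m := Fintype.card κ) (QuadraticMap.Equivalent.symm
    ⟨⟨E, ?_⟩⟩)
  rintro ⟨a, p, r⟩
  -- Each product `p i * r i` occurs twice, which is why the duality is normalised to `2⁻¹`.
  have h5 : B (T (a, (p, r))) (T (a, (p, r))) = (∑ i, a i * (a i * w i)) +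
      ((∑ i, p i * (r i * 2⁻¹)) + ∑ i, r i * (p i * 2⁻¹)) := by
    conv_lhs => enter [2]; rw [hT a p r]
    simp only [map_add, map_sum, map_smul, h1, h3, h4, Equiv.apply_symm_apply, smul_eq_mul]
  change B (T (a, (p, r))) (T (a, (p, r))) = _
  rw [h5, QuadraticMap.prod_apply, hyperbolicSpace_apply, QuadraticMap.weightedSumSquares_apply,
    ← Finset.sum_add_distrib]
  congr 1
  · exact Finset.sum_congr rfl fun i _ => by simp only [smul_eq_mul]; ring
  · exact Finset.sum_congr rfl fun i _ => by field_simp; ring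

end Witt
end TraceForms

namespace TraceForms

/-! ### The modular group, recognised by a pair of generators. -/

section Group

/-- `s` and `t` generate a modular group of order `4 * N`. -/
structure IsModularPair {G : Type*} [Group G] (N : ℕ) (s t : G) : Prop where
  orderOf_eq : orderOf s = 2 * N
  sq_eq : t ^ 2 = 1
  conj_eq : t * s * t = s ^ (1 + N)
  notMem : t ∉ Subgroup.zpowers s
  closure_eq : Subgroup.closure {s, t} = ⊤

variable {G : Type*} [Group G]

theorem mul_pow_of_conj {N : ℕ} {s t : G} (ht : t ^ 2 = 1) (h : t * s * t = s ^ (1 + N)) (i : ℕ) :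
    t * s ^ i = s ^ ((1 + N) * i) * t := by
  have htt : t * t = 1 := by rw [← sq, ht]
  have hs : t * s = s ^ (1 + N) * t := by rw [← h, mul_assoc, htt, mul_one]
  rw [pow_mul]
  exact (SemiconjBy.pow_right hs i)

theorem exists_eq_pow_mul_pow {N : ℕ} {s t : G} (hs : s ^ (2 * N) = 1) (hN : 0 < N)
    (ht : t ^ 2 = 1) (h : t * s * t = s ^ (1 + N)) (hg : Subgroup.closure {s, t} = ⊤) (g : G) :
    ∃ i < 2 * N, ∃ j < 2, g = s ^ i * t ^ j := by
  suffices ∃ i j : ℕ, g = s ^ i * t ^ j by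
    obtain ⟨i, j, rfl⟩ := this
    refine ⟨i % (2 * N), Nat.mod_lt _ (by omega), j % 2, Nat.mod_lt _ (by omega), ?_⟩
    rw [← pow_eq_pow_mod i hs, ← pow_eq_pow_mod j ht]
  have hcomm : ∀ j i : ℕ, ∃ k : ℕ, t ^ j * s ^ i = s ^ k * t ^ j := by
    intro j
    induction j with
    | zero => exact fun i => ⟨i, by simp⟩
    | succ j ih =>
      intro i
      obtain ⟨k, hk⟩ := ih ((1 + N) * i)
      exact ⟨k, by rw [pow_succ, mul_assoc, mul_pow_of_conj ht h, ← mul_assoc, hk, mul_assoc]⟩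
  have hgm : g ∈ Subgroup.closure {s, t} := hg ▸ Subgroup.mem_top g
  induction hgm using Subgroup.closure_induction with
  | mem x hx =>
    rcases hx with rfl | rfl
    · exact ⟨1, 0, by simp⟩
    · exact ⟨0, 1, by simp⟩
  | one => exact ⟨0, 0, by simp⟩
  | mul x y _ _ hx hy =>
    obtain ⟨i, j, rfl⟩ := hx
    obtain ⟨i', j', rfl⟩ := hy
    obtain ⟨k, hk⟩ := hcomm j i'
    exact ⟨i + k, j + j', by
      rw [pow_add, pow_add, mul_assoc, ← mul_assoc (t ^ j), hk]; simp only [mul_assoc]⟩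
  | inv x _ hx =>
    obtain ⟨i, j, rfl⟩ := hx
    have hsi : (s ^ i)⁻¹ = s ^ ((2 * N - 1) * i) := by
      rw [inv_eq_iff_mul_eq_one, ← pow_add, show i + (2 * N - 1) * i = 2 * N * i by
        rw [Nat.sub_mul, one_mul, Nat.add_sub_cancel' (Nat.le_mul_of_pos_left i (by omega))],
        pow_mul, hs, one_pow]
    have htj : (t ^ j)⁻¹ = t ^ j := by
      rw [inv_eq_iff_mul_eq_one, ← pow_add, ← two_mul, pow_mul, ht, one_pow]
    obtain ⟨k, hk⟩ := hcomm j ((2 * N - 1) * i)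
    exact ⟨k, j, by rw [mul_inv_rev, hsi, htj, hk]⟩

namespace IsModularPair

variable {N : ℕ} {s t : G}

theorem pow_eq_one (h : IsModularPair N s t) : s ^ (2 * N) = 1 := by
  rw [← h.orderOf_eq, pow_orderOf_eq_one]

theorem eq_of_pow_mul_pow_eq (h : IsModularPair N s t) {i i' j j' : ℕ} (hi : i < 2 * N)
    (hi' : i' < 2 * N) (hj : j < 2) (hj' : j' < 2)
    (he : s ^ i * t ^ j = s ^ i' * t ^ j') : i = i' ∧ j = j' := by
  have hjj : j = j' := by
    by_contra hne
    apply h.notMem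
    have hm : ∀ k : ℕ, s ^ k ∈ Subgroup.zpowers s := fun k => Subgroup.npow_mem_zpowers s k
    have : t = (s ^ i')⁻¹ * s ^ i ∨ t = (s ^ i)⁻¹ * s ^ i' := by
      obtain ⟨rfl, rfl⟩ | ⟨rfl, rfl⟩ : (j = 0 ∧ j' = 1) ∨ (j = 1 ∧ j' = 0) := by omega
      · left; rw [eq_inv_mul_iff_mul_eq]; simpa using he.symm
      · right; rw [eq_inv_mul_iff_mul_eq]; simpa using he
    rcases this with h | h <;> rw [h] <;> exact mul_mem (inv_mem (hm _)) (hm _)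
  subst hjj
  refine ⟨?_, rfl⟩
  have := mul_right_cancel he
  exact pow_injOn_Iio_orderOf (by rw [h.orderOf_eq]; exact hi) (by rw [h.orderOf_eq]; exact hi') this

theorem exists_eq (h : IsModularPair N s t) (hN : 0 < N) (g : G) :
    ∃ i < 2 * N, ∃ j < 2, g = s ^ i * t ^ j :=
  exists_eq_pow_mul_pow h.pow_eq_one hN h.sq_eq h.conj_eq h.closure_eq g

theorem natCard_eq (h : IsModularPair N s t) (hN : 0 < N) : Nat.card G = 4 * N := by
  have hb : Function.Bijective (fun p : Fin (2 * N) × Fin 2 => s ^ (p.1 : ℕ) * t ^ (p.2 : ℕ)) := by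
    constructor
    · rintro ⟨i, j⟩ ⟨i', j'⟩ he
      obtain ⟨h1, h2⟩ := h.eq_of_pow_mul_pow_eq i.2 i'.2 j.2 j'.2 he
      exact Prod.ext (Fin.ext h1) (Fin.ext h2)
    · intro g
      obtain ⟨i, hi, j, hj, rfl⟩ := h.exists_eq hN g
      exact ⟨(⟨i, hi⟩, ⟨j, hj⟩), rfl⟩
  rw [← Nat.card_congr (Equiv.ofBijective _ hb)]
  simp; ring

theorem map {H : Type*} [Group H] (e : G ≃* H) (h : IsModularPair N s t) :
    IsModularPair N (e s) (e t) where
  orderOf_eq := by rw [MulEquiv.orderOf_eq, h.orderOf_eq]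
  sq_eq := by rw [← map_pow, h.sq_eq, map_one]
  conj_eq := by rw [← map_mul, ← map_mul, h.conj_eq, map_pow]
  notMem := by
    rintro ⟨k, hk⟩
    exact h.notMem ⟨k, e.injective (by simpa using hk)⟩
  closure_eq := by
    have := MonoidHom.map_closure e.toMonoidHom {s, t}
    rw [h.closure_eq, Subgroup.map_top_of_surjective _ e.surjective, Set.image_pair] at this
    exact this.symm

end IsModularPair

theorem modularRelators_lift {n : ℕ} {s t : G} (hs : s ^ 2 ^ (n - 1) = 1)
    (ht : t ^ 2 = 1) (h : t * s * t = s ^ (1 + 2 ^ (n - 2))) :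
    ∀ r ∈ modularRelators n, FreeGroup.lift ![s, t] r = 1 := by
  rintro r (rfl | rfl | rfl)
  · simpa using hs
  · simpa using ht
  · simp [h]

/-- The relators only bound the order of `σ` from above. The lower bound comes from a model: the
maps `x + 1` and `(1 + N) * x` on `ZMod (2 * N)` satisfy the relators, and the first has order `2 *
N`. -/
theorem isModularPair_of {n : ℕ} (hn : 4 ≤ n) :
    IsModularPair (G := ModularTwoGroup n) (2 ^ (n - 2)) (PresentedGroup.of 0)
      (PresentedGroup.of 1) := by
  have hrel : ∀ r ∈ modularRelators n, PresentedGroup.mk (modularRelators n) r = 1 :=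
    fun r hr => (QuotientGroup.eq_one_iff r).2 (Subgroup.subset_normalClosure hr)
  have h2N : 2 ^ (n - 1) = 2 * 2 ^ (n - 2) := by
    rw [← pow_succ']; congr 1; omega
  have hs := hrel _ (Or.inl rfl)
  have ht := hrel _ (Or.inr (Or.inl rfl))
  have hc := hrel _ (Or.inr (Or.inr rfl))
  simp only [map_pow, map_mul, map_inv] at hs ht hc
  have hc' := mul_inv_eq_one.1 hc
  let N := 2 ^ (n - 2)
  have hN4 : 2 * 2 ∣ N := pow_dvd_pow 2 (by omega : 2 ≤ n - 2)
  have hN : 0 < N := by positivity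
  have : NeZero (2 * N) := ⟨by omega⟩
  -- `(1 + N) ^ 2 = 1 + 2N + N ^ 2`, and `2N` divides `N ^ 2` because `N` is even.
  have hNN : ((1 + N : ℕ) : ZMod (2 * N)) * ((1 + N : ℕ) : ZMod (2 * N)) = 1 := by
    have h0 : ((2 * N : ℕ) : ZMod (2 * N)) = 0 := ZMod.natCast_self _
    obtain ⟨k, hk⟩ := hN4
    have : (1 + N) * (1 + N) = 1 + (2 * N) * (1 + 2 * k) := by
      have h3 : N * N = (2 * N) * (2 * k) := by
        conv_lhs => rw [mul_comm]; enter [1]; rw [hk]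
        ring
      linear_combination h3
    rw [← Nat.cast_mul, this, Nat.cast_add, Nat.cast_mul, h0]
    simp
  let S : Equiv.Perm (ZMod (2 * N)) := Equiv.addRight 1
  let T : Equiv.Perm (ZMod (2 * N)) :=
    ⟨fun x => ((1 + N : ℕ) : ZMod (2 * N)) * x, fun x => ((1 + N : ℕ) : ZMod (2 * N)) * x,
      fun x => by simp only [← mul_assoc, hNN, one_mul],
      fun x => by simp only [← mul_assoc, hNN, one_mul]⟩
  have hS : ∀ (k : ℕ) (x : ZMod (2 * N)), (S ^ k) x = x + k := by
    intro k x
    simp [S]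
  have hTT : ∀ x, T (T x) = x := fun x => T.left_inv x
  let φ : ModularTwoGroup n →* Equiv.Perm (ZMod (2 * N)) :=
    PresentedGroup.toGroup (f := ![S, T]) (modularRelators_lift
      (by ext x; rw [hS, h2N, ZMod.natCast_self]; simp)
      (by ext x; rw [sq, Equiv.Perm.mul_apply, hTT]; simp)
      (by
        ext x
        rw [Equiv.Perm.mul_apply, Equiv.Perm.mul_apply, hS]
        have : T (S (T x)) = T (T x) + (1 + N : ℕ) := by simp [T, S, mul_add]
        rw [this, hTT]))
  have hφs : φ (PresentedGroup.of 0) = S := by simp [φ]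
  have hφt : φ (PresentedGroup.of 1) = T := by simp [φ]
  have hord : orderOf (PresentedGroup.of 0 : ModularTwoGroup n) = 2 * N := by
    apply Nat.dvd_antisymm
    · rw [orderOf_dvd_iff_pow_eq_one, ← h2N]; exact hs
    · have h1 := congrArg φ (pow_orderOf_eq_one (PresentedGroup.of 0 : ModularTwoGroup n))
      rw [map_pow, hφs, map_one] at h1
      have := congrArg (fun f : Equiv.Perm _ => f 0) h1
      simp only [hS] at this
      rw [← ZMod.natCast_eq_zero_iff]
      simpa using this
  refine ⟨hord, ht, hc', ?_, ?_⟩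
  -- If `τ` were a power of `σ` the two would commute, and the conjugation relation would force `σ ^
  -- N = 1`.
  · intro hmem
    have hcomm : Commute (PresentedGroup.of 0 : ModularTwoGroup n) (PresentedGroup.of 1) := by
      obtain ⟨k, hk⟩ := hmem
      rw [← hk]
      exact (Commute.refl _).zpow_right k
    have ht' : (PresentedGroup.of 1 : ModularTwoGroup n) ^ 2 = 1 := ht
    have hc'' : (PresentedGroup.of 1 : ModularTwoGroup n) * PresentedGroup.of 0 *
      PresentedGroup.of 1 = PresentedGroup.of 0 ^ (1 + N) := hc'
    rw [← hcomm.eq, mul_assoc, ← sq, ht', mul_one, pow_add, pow_one, left_eq_mul,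
      ← orderOf_dvd_iff_pow_eq_one, hord] at hc''
    exact absurd (Nat.le_of_dvd hN hc'') (by omega)
  · rw [← PresentedGroup.closure_range_of]
    congr 1
    ext x
    simp [Fin.exists_fin_two, eq_comm]

/-- Both groups have the unique normal form `s ^ i * t ^ j` with `i < 2N`, `j < 2`. -/
theorem IsModularPair.nonempty_mulEquiv {n : ℕ} (hn : 4 ≤ n) {s t : G}
    (h : IsModularPair (2 ^ (n - 2)) s t) : Nonempty (G ≃* ModularTwoGroup n) := by
  have h2N : 2 ^ (n - 1) = 2 * 2 ^ (n - 2) := by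
    rw [← pow_succ']; congr 1; omega
  let φ : ModularTwoGroup n →* G := PresentedGroup.toGroup (f := ![s, t])
    (modularRelators_lift (by rw [h2N, h.pow_eq_one]) h.sq_eq h.conj_eq)
  have hφs : φ (PresentedGroup.of 0) = s := by simp [φ]
  have hφt : φ (PresentedGroup.of 1) = t := by simp [φ]
  have hN : 0 < 2 ^ (n - 2) := by positivity
  refine ⟨(MulEquiv.ofBijective φ ⟨?_, fun g => ?_⟩).symm⟩
  · rw [injective_iff_map_eq_one]
    intro g hg
    obtain ⟨i, hi, j, hj, rfl⟩ := (isModularPair_of hn).exists_eq hN g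
    rw [map_mul, map_pow, map_pow, hφs, hφt] at hg
    obtain ⟨rfl, rfl⟩ := h.eq_of_pow_mul_pow_eq (i' := 0) (j' := 0) hi (by omega) hj (by omega)
      (by simpa using hg)
    simp
  · obtain ⟨i, hi, j, hj, rfl⟩ := h.exists_eq hN g
    exact ⟨PresentedGroup.of 0 ^ i * PresentedGroup.of 1 ^ j, by
      rw [map_mul, map_pow, map_pow, hφs, hφt]⟩

end Group
end TraceForms

namespace TraceForms

/-! ### The trace form through eigenvectors of automorphisms. -/

section TraceForm

variable {K : Type u} {L : Type v} [Field K] [Field L] [Algebra K L]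

/-- `x` is an eigenvector of the automorphism `g` with eigenvalue `l`. -/
def IsEigen (g : L ≃ₐ[K] L) (l : K) (x : L) : Prop :=
  g x = algebraMap K L l * x

namespace IsEigen

variable {g : L ≃ₐ[K] L} {l m : K} {x y : L}

theorem mul (hx : IsEigen g l x) (hy : IsEigen g m y) : IsEigen g (l * m) (x * y) := by
  unfold IsEigen at *
  rw [map_mul, hx, hy, map_mul]; ring

theorem inv (hx : IsEigen g l x) : IsEigen g l⁻¹ x⁻¹ := by
  unfold IsEigen at *
  rw [map_inv₀, hx, map_inv₀, mul_inv]

theorem pow (hx : IsEigen g l x) (k : ℕ) : IsEigen g (l ^ k) (x ^ k) := by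
  unfold IsEigen at *
  rw [map_pow, hx, mul_pow, map_pow]

theorem trace_eq_zero [FiniteDimensional K L] (hx : IsEigen g l x) (hl : l ≠ 1) :
    Algebra.trace K L x = 0 := by
  have h1 : Algebra.trace K L (g x) = Algebra.trace K L x := Algebra.trace_eq_of_algEquiv g x
  rw [show g x = l • x by rw [hx, Algebra.smul_def], map_smul, smul_eq_mul] at h1
  have : (l - 1) * Algebra.trace K L x = 0 := by rw [sub_mul, h1]; ring
  exact (mul_eq_zero.1 this).resolve_left (sub_ne_zero.2 hl)

end IsEigen

theorem primitiveRoot_pow_half {R : Type*} [CommRing R] [IsDomain R] {ζ : R} {m : ℕ} (hm : 0 < m)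
    (hζ : IsPrimitiveRoot ζ (2 * m)) : ζ ^ m = -1 := by
  have h1 : (ζ ^ m) ^ 2 = 1 := by rw [← pow_mul, mul_comm, hζ.pow_eq_one]
  refine (mul_self_eq_one_iff.1 (by rwa [← sq])).resolve_left fun h => ?_
  have := Nat.le_of_dvd hm (hζ.dvd_of_pow_eq_one _ h)
  omega

-- The vectors `1, β, ρ ^ 2, β ρ ^ 2` span the fixed field of `σ ^ 2` and are trace-orthogonal; the
-- remaining eigenvectors pair with their inverses. All orthogonality is proved by exhibiting an
-- automorphism that scales the product by a factor other than 1.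
set_option maxHeartbeats 1000000 in
theorem wittEquivalent_traceForm [FiniteDimensional K L] {M : ℕ} (hM : 0 < M) {ζ : K}
    (hζ : IsPrimitiveRoot ζ (4 * M)) (hdim : Module.finrank K L = 16 * M) {σ τ : L ≃ₐ[K] L}
    {v β ρ : L} (hv : v ≠ 0) (hβ : β ≠ 0) (hρ : ρ ≠ 0)
    (hσv : σ (σ v) = algebraMap K L ζ * v) (hσβ : σ β = β) (hτβ : τ β = -β) (hτρ : τ ρ = ρ)
    (hσρ : σ ρ = algebraMap K L (ζ ^ M) * ρ) {b c : K} (hb : β ^ 2 = algebraMap K L b)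
    (hc : ρ ^ 4 = algebraMap K L c) :
    WittEquivalent (traceQuadraticForm K L) (QuadraticMap.weightedSumSquares K
      ![((16 * M : ℕ) : K), (16 * M : ℕ) * b, (16 * M : ℕ) * c, (16 * M : ℕ) * (b * c)]) := by
  have : NeZero (4 * M) := ⟨by omega⟩
  have h4M : ((4 * M : ℕ) : K) ≠ 0 := hζ.neZero'.out
  have h4 : (2 : K) ≠ 0 ∧ (M : K) ≠ 0 := by
    have h4' : (4 : K) ≠ 0 ∧ (M : K) ≠ 0 := by simpa using h4M
    refine ⟨fun h => h4'.1 ?_, h4'.2⟩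
    linear_combination 2 * h
  obtain ⟨h2, hMK⟩ := h4
  have hS : ((16 * M : ℕ) : K) ≠ 0 := by
    rw [show ((16 * M : ℕ) : K) = 2 * 2 * 2 * 2 * M by push_cast; ring]
    exact mul_ne_zero (mul_ne_zero (mul_ne_zero (mul_ne_zero h2 h2) h2) h2) hMK
  have hb0 : b ≠ 0 := by
    rintro rfl; apply hβ; simpa using hb
  have hc0 : c ≠ 0 := by
    rintro rfl; apply hρ; simpa using hc
  have hneg : (-1 : K) ≠ 1 := fun h => h2 (by linear_combination -h)
  have hζ2M : ζ ^ (2 * M) = -1 :=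
    primitiveRoot_pow_half (by omega) (by rwa [show 2 * (2 * M) = 4 * M by ring])
  have hζne : ∀ i, 0 < i → i < 4 * M → ζ ^ i ≠ 1 := fun i hi hi' =>
    hζ.pow_ne_one_of_pos_of_lt (by omega) hi'
  have hζdiv : ∀ i j, i < 4 * M → j < 4 * M → i ≠ j → ζ ^ i * (ζ ^ j)⁻¹ ≠ 1 := by
    intro i j hi hj hij he
    rw [mul_inv_eq_one₀ (pow_ne_zero _ (hζ.ne_zero (by omega)))] at he
    exact hij (hζ.pow_inj hi hj he)
  have eσβ : IsEigen σ 1 β := by simp [IsEigen, hσβ]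
  have eτβ : IsEigen τ (-1) β := by simp [IsEigen, hτβ]
  have eτρ : IsEigen τ 1 ρ := by simp [IsEigen, hτρ]
  have eσρ : IsEigen σ (ζ ^ M) ρ := hσρ
  have eσρ2 : IsEigen σ (-1) (ρ ^ 2) := by
    have := eσρ.pow 2
    rwa [← pow_mul, mul_comm, hζ2M] at this
  have eσσv : IsEigen (σ * σ) ζ v := hσv
  have eσσβ : IsEigen (σ * σ) 1 β := by simp [IsEigen, hσβ]
  have eσσρ : IsEigen (σ * σ) (ζ ^ (2 * M)) ρ := by
    simp [IsEigen, hσρ]; ring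
  have eσσρ2 : IsEigen (σ * σ) 1 (ρ ^ 2) := by
    have := eσσρ.pow 2
    rwa [hζ2M, neg_one_sq] at this
  let f : Fin 4 → L := ![1, β, ρ ^ 2, β * ρ ^ 2]
  -- `x i` has `σ ^ 2`-eigenvalue `ζ ^ d i`. For `0 < d < 2M` the whole four-dimensional eigenspace
  -- is used. For `d = 2M`, eigenvalue `-1`, the space is its own dual, so only the isotropic half
  -- spanned by `ρ`, `ρ β` is taken.
  let d : (Fin (2 * M - 1) × Fin 2 × Fin 2) ⊕ Fin 2 → ℕ :=
    Sum.elim (fun p => p.1 + 1) (fun _ => 2 * M)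
  let x : (Fin (2 * M - 1) × Fin 2 × Fin 2) ⊕ Fin 2 → L :=
    Sum.elim (fun p => v ^ ((p.1 : ℕ) + 1) * (β ^ (p.2.1 : ℕ) * (ρ ^ 2) ^ (p.2.2 : ℕ)))
      (fun j => ρ * β ^ (j : ℕ))
  -- The factor normalises `tr (x i * y i)` to `2⁻¹`, since `tr 1 = 16M`.
  let y : (Fin (2 * M - 1) × Fin 2 × Fin 2) ⊕ Fin 2 → L :=
    fun i => ((16 * M : ℕ) * 2 : K)⁻¹ • (x i)⁻¹
  have hx0 : ∀ i, x i ≠ 0 := by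
    rintro (p | j) <;> simp [x, hv, hβ, hρ]
  have hdx : ∀ i, 0 < d i ∧ d i ≤ 2 * M := by
    rintro (⟨p, p'⟩ | j)
    · have := p.2; constructor <;> simp only [d, Sum.elim_inl] <;> omega
    · constructor <;> simp only [d, Sum.elim_inr] <;> omega
  have ef : ∀ i, IsEigen (σ * σ) 1 (f i) := by
    intro i
    fin_cases i
    · simp [IsEigen, f]
    · exact eσσβ
    · exact eσσρ2
    · simpa [f] using eσσβ.mul eσσρ2
  have ex : ∀ i, IsEigen (σ * σ) (ζ ^ d i) (x i) := by
    rintro (p | j)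
    · simpa [d, x] using (eσσv.pow _).mul ((eσσβ.pow p.2.1).mul (eσσρ2.pow p.2.2))
    · simpa [d, x] using eσσρ.mul (eσσβ.pow j)
  have exx : ∀ i j, ∃ (g : L ≃ₐ[K] L) (l : K), l ≠ 1 ∧ IsEigen g l (x i * x j) := by
    intro i j
    by_cases hij : d i + d j < 4 * M
    · exact ⟨_, _, hζne _ (by have := (hdx i).1; omega) hij, by
        rw [pow_add]; exact (ex i).mul (ex j)⟩
    -- The exponents reach `4M` only if both equal `2M`; then `σ` separates, because the product
    -- contains `ρ ^ 2`.
    · rcases i with p | i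
      · exfalso
        have h1 := (hdx j).2
        have h2 := p.1.2
        simp only [d, Sum.elim_inl] at hij h1
        omega
      rcases j with p | j
      · exfalso
        have h1 := p.1.2
        simp only [d, Sum.elim_inl, Sum.elim_inr] at hij
        omega
      refine ⟨σ, -1, hneg, ?_⟩
      have := (eσρ2.mul (eσβ.pow i)).mul (eσβ.pow j)
      simp only [one_pow, mul_one] at this
      convert this using 1
      simp only [x, Sum.elim_inr]; ring
  have exy : ∀ i j, i ≠ j → ∃ (g : L ≃ₐ[K] L) (l : K), l ≠ 1 ∧ IsEigen g l (x i * (x j)⁻¹) := by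
    intro i j hij
    -- For equal exponents the powers of `v`, or the factors `ρ`, cancel in the quotient, leaving
    -- powers of `β`, detected by `τ`, and of `ρ ^ 2`, detected by `σ`.
    by_cases hd : d i = d j
    · have fin2 : ∀ i j : Fin 2, i ≠ j → ((-1 : K) ^ (i : ℕ) * ((-1) ^ (j : ℕ))⁻¹) ≠ 1 := by
        intro i j hij
        fin_cases i <;> fin_cases j <;> simp_all [neg_eq_iff_eq_neg]
      rcases i with ⟨i, i', i''⟩ | i <;> rcases j with ⟨j, j', j''⟩ | j
      · have hij' : i = j := Fin.ext (by simpa [d] using hd)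
        subst hij'
        have hxy : x (Sum.inl (i, i', i'')) * (x (Sum.inl (i, j', j'')))⁻¹ =
            (β ^ (i' : ℕ) * (β ^ (j' : ℕ))⁻¹) *
              ((ρ ^ 2) ^ (i'' : ℕ) * ((ρ ^ 2) ^ (j'' : ℕ))⁻¹) := by
          simp only [x, Sum.elim_inl]
          field_simp
        by_cases h' : i' = j'
        · subst h'
          have h'' : i'' ≠ j'' := by rintro rfl; exact hij rfl
          refine ⟨σ, _, fin2 i'' j'' h'', ?_⟩
          rw [hxy, mul_inv_cancel₀ (pow_ne_zero _ hβ), one_mul]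
          exact (eσρ2.pow _).mul (eσρ2.pow _).inv
        · refine ⟨τ, _, fin2 i' j' h', ?_⟩
          rw [hxy]
          simpa using ((eτβ.pow i').mul (eτβ.pow j').inv).mul
            (((eτρ.pow 2).pow i'').mul ((eτρ.pow 2).pow j'').inv)
      · have := i.2; simp only [d, Sum.elim_inl, Sum.elim_inr] at hd; omega
      · have := j.2; simp only [d, Sum.elim_inl, Sum.elim_inr] at hd; omega
      · have h' : i ≠ j := by rintro rfl; exact hij rfl
        refine ⟨τ, _, fin2 i j h', ?_⟩
        have hxy : x (Sum.inr i) * (x (Sum.inr j))⁻¹ = β ^ (i : ℕ) * (β ^ (j : ℕ))⁻¹ := by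
          simp only [x, Sum.elim_inr]
          field_simp
        rw [hxy]
        exact (eτβ.pow i).mul (eτβ.pow j).inv
    · exact ⟨_, _, hζdiv _ _ (by have := (hdx i).2; omega) (by have := (hdx j).2; omega) hd,
        (ex i).mul (ex j).inv⟩
  have tr : ∀ a, Algebra.trace K L (algebraMap K L a) = (16 * M : ℕ) * a := by
    intro a; rw [Algebra.trace_algebraMap, hdim, nsmul_eq_mul]
  have tβ : Algebra.trace K L β = 0 := eτβ.trace_eq_zero hneg
  have tρ : Algebra.trace K L (ρ ^ 2) = 0 := eσρ2.trace_eq_zero hneg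
  have tβρ : Algebra.trace K L (β * ρ ^ 2) = 0 :=
    (eτβ.mul (eτρ.pow 2)).trace_eq_zero (by simpa using hneg)
  have trm : ∀ (a : K) (z : L), Algebra.trace K L z = 0 →
      Algebra.trace K L (algebraMap K L a * z) = 0 := by
    intro a z hz; rw [← Algebra.smul_def, map_smul, hz, smul_zero]
  have hff : ∀ i j, Algebra.trace K L (f i * f j) = if i = j then
      ![((16 * M : ℕ) : K), (16 * M : ℕ) * b, (16 * M : ℕ) * c, (16 * M : ℕ) * (b * c)] i
      else 0 := by
    have hle : ∀ i j, i < j → Algebra.trace K L (f i * f j) = 0 := by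
      intro i j hij
      fin_cases i <;> fin_cases j <;> simp at hij
      · simpa [f] using tβ
      · simpa [f] using tρ
      · simpa [f] using tβρ
      · exact tβρ
      · change Algebra.trace K L (β * (β * ρ ^ 2)) = 0
        rw [← mul_assoc, ← sq, hb]; exact trm _ _ tρ
      · change Algebra.trace K L (ρ ^ 2 * (β * ρ ^ 2)) = 0
        rw [show ρ ^ 2 * (β * ρ ^ 2) = ρ ^ 4 * β by ring, hc]; exact trm _ _ tβ
    intro i j
    rcases lt_trichotomy i j with h | rfl | h
    · rw [hle i j h, if_neg h.ne]
    · rw [if_pos rfl]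
      fin_cases i
      · simpa [f] using tr 1
      · simpa [f, ← sq, hb] using tr b
      · simpa [f, ← pow_add, hc] using tr c
      · have := tr (b * c)
        rw [map_mul, ← hb, ← hc] at this
        change Algebra.trace K L (β * ρ ^ 2 * (β * ρ ^ 2)) = (16 * M : ℕ) * (b * c)
        rw [← this]; congr 1; ring
    · rw [mul_comm, hle j i h, if_neg h.ne']
  refine wittEquivalent_weightedSumSquares_of_gram h2 (Algebra.traceForm K L)
    (fun a b => by rw [Algebra.traceForm_apply, Algebra.traceForm_apply, mul_comm]) f x y _ ?_
    (fun i j => by rw [Algebra.traceForm_apply, hff]) ?_ ?_ ?_ ?_ ?_ ?_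
  · intro i
    fin_cases i
    exacts [hS, mul_ne_zero hS hb0, mul_ne_zero hS hc0, mul_ne_zero hS (mul_ne_zero hb0 hc0)]
  · intro i j
    exact ((ef i).mul (ex j)).trace_eq_zero
      (by rw [one_mul]; exact hζne _ (hdx j).1 (by have := (hdx j).2; omega))
  · intro i j
    simp only [y, map_smul, Algebra.traceForm_apply]
    rw [((ef i).mul (ex j).inv).trace_eq_zero, smul_zero]
    rw [one_mul, ne_eq, inv_eq_one]
    exact hζne _ (hdx j).1 (by have := (hdx j).2; omega)
  · intro i j
    obtain ⟨g, l, hl, he⟩ := exx i j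
    exact he.trace_eq_zero hl
  · intro i j
    obtain ⟨g, l, hl, he⟩ := exx i j
    simp only [y, map_smul, LinearMap.smul_apply, Algebra.traceForm_apply]
    rw [← mul_inv, he.inv.trace_eq_zero (by rwa [ne_eq, inv_eq_one]), smul_zero, smul_zero]
  · intro i j
    simp only [y, map_smul, Algebra.traceForm_apply]
    by_cases hij : i = j
    · subst hij
      have := tr 1
      rw [map_one] at this
      rw [mul_inv_cancel₀ (hx0 i), this, if_pos rfl, smul_eq_mul]
      field_simp
    · obtain ⟨g, l, hl, he⟩ := exy i j hij
      rw [he.trace_eq_zero hl, if_neg hij, smul_zero]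
  · rw [hdim]; simp; omega

end TraceForm
end TraceForms

namespace TraceForms

/-! ### Square classes and four-dimensional diagonal forms. -/

section Forms

variable {K : Type u} [Field K]

theorem squareClass_eq_iff {a b : Kˣ} :
    squareClass a = squareClass b ↔ ∃ z : K, (a : K) = b * z ^ 2 := by
  unfold squareClass
  rw [eq_comm, QuotientGroup.eq, Subgroup.mem_square]
  constructor
  · rintro ⟨z, hz⟩
    refine ⟨z, ?_⟩
    rw [inv_mul_eq_iff_eq_mul] at hz
    rw [hz]; push_cast; ring
  · rintro ⟨z, hz⟩
    have hz0 : z ≠ 0 := by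
      rintro rfl
      simp at hz
    refine ⟨Units.mk0 z hz0, ?_⟩
    rw [inv_mul_eq_iff_eq_mul]
    ext
    simp [hz, sq]

theorem weightedSumSquares_equivalent_of_sq {ι : Type*} [Fintype ι] {w w' : ι → K} (u : ι → K)
    (hu : ∀ i, u i ≠ 0) (h : ∀ i, w' i * u i ^ 2 = w i) :
    (QuadraticMap.weightedSumSquares K w).Equivalent (QuadraticMap.weightedSumSquares K w') :=
  ⟨QuadraticForm.isometryEquivWeightedSumSquaresWeightedSumSquares
    (fun i => Units.mk0 (u i) (hu i)) h⟩

theorem weightedSumSquares_scale_equivalent {r s b c : K} (hr : r ≠ 0) (hs : s = r ^ 2) :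
    (QuadraticMap.weightedSumSquares K ![s, s * b, s * c, s * (b * c)]).Equivalent
      (QuadraticMap.weightedSumSquares K ![1, b, c, b * c]) :=
  weightedSumSquares_equivalent_of_sq (fun _ => r) (fun _ => hr) (by
    subst hs
    intro i; fin_cases i
    · change 1 * r ^ 2 = r ^ 2; ring
    · change b * r ^ 2 = r ^ 2 * b; ring
    · change c * r ^ 2 = r ^ 2 * c; ring
    · change b * c * r ^ 2 = r ^ 2 * (b * c); ring)

theorem weightedSumSquares_swap_equivalent (b c : K) :
    (QuadraticMap.weightedSumSquares K ![1, b, c, b * c]).Equivalent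
      (QuadraticMap.weightedSumSquares K ![1, c, b, c * b]) := by
  refine ⟨⟨LinearEquiv.funCongrLeft K K (Equiv.swap (1 : Fin 4) 2), fun x => ?_⟩⟩
  simp only [QuadraticMap.weightedSumSquares_apply, Fin.sum_univ_four, smul_eq_mul]
  change 1 * (x 0 * x 0) + c * (x 2 * x 2) + b * (x 1 * x 1) + c * b * (x 3 * x 3) =
    1 * (x 0 * x 0) + b * (x 1 * x 1) + c * (x 2 * x 2) + b * c * (x 3 * x 3)
  ring

/-- Multiplication by an element of the quadratic extension given by `c`. -/
theorem weightedSumSquares_norm_equivalent {I b c e r s : K} (hI : I ^ 2 = -1) (he : e ≠ 0)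
    (h : e = b * (r ^ 2 - c * s ^ 2)) :
    (QuadraticMap.weightedSumSquares K ![1, e, c, e * c]).Equivalent
      (QuadraticMap.weightedSumSquares K ![1, b, c, b * c]) := by
  have hD : r ^ 2 - c * s ^ 2 ≠ 0 := fun h0 => he (by rw [h, h0, mul_zero])
  set D := r ^ 2 - c * s ^ 2 with hDdef
  have hDi : D⁻¹ * D = 1 := inv_mul_cancel₀ hD
  -- With `I = √-1`, the form `X ^ 2 + c Y ^ 2` is the norm of `X + I Y √c`. The middle coordinates
  -- come from multiplying by `r + s √c`, of norm `D`, which turns `e = b D` into `b`.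
  refine ⟨⟨⟨⟨⟨fun y => ![y 0, r * y 1 + c * s * I * y 3, y 2, r * y 3 - I * s * y 1], ?_⟩, ?_⟩,
    fun x => ![x 0, D⁻¹ * (r * x 1 - c * s * I * x 3), x 2, D⁻¹ * (r * x 3 + I * s * x 1)],
    ?_, ?_⟩, ?_⟩⟩
  · intro x y
    ext i; fin_cases i
    · rfl
    · simp; ring
    · rfl
    · simp; ring
  · intro a x
    ext i; fin_cases i
    · rfl
    · simp; ring
    · rfl
    · simp; ring
  · intro y
    ext i; fin_cases i
    · rfl
    · change D⁻¹ * (r * (r * y 1 + c * s * I * y 3) - c * s * I * (r * y 3 - I * s * y 1)) = y 1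
      linear_combination y 1 * hDi + D⁻¹ * c * s ^ 2 * y 1 * hI - D⁻¹ * y 1 * hDdef
    · rfl
    · change D⁻¹ * (r * (r * y 3 - I * s * y 1) + I * s * (r * y 1 + c * s * I * y 3)) = y 3
      linear_combination y 3 * hDi + D⁻¹ * c * s ^ 2 * y 3 * hI - D⁻¹ * y 3 * hDdef
  · intro x
    ext i; fin_cases i
    · rfl
    · change r * (D⁻¹ * (r * x 1 - c * s * I * x 3)) +
        c * s * I * (D⁻¹ * (r * x 3 + I * s * x 1)) = x 1
      linear_combination x 1 * hDi + D⁻¹ * c * s ^ 2 * x 1 * hI - D⁻¹ * x 1 * hDdef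
    · rfl
    · change r * (D⁻¹ * (r * x 3 + I * s * x 1)) -
        I * s * (D⁻¹ * (r * x 1 - c * s * I * x 3)) = x 3
      linear_combination x 3 * hDi + D⁻¹ * c * s ^ 2 * x 3 * hI - D⁻¹ * x 3 * hDdef
  · intro y
    simp only [QuadraticMap.weightedSumSquares_apply, Fin.sum_univ_four, smul_eq_mul]
    change 1 * (y 0 * y 0) + b * ((r * y 1 + c * s * I * y 3) * (r * y 1 + c * s * I * y 3)) +
      c * (y 2 * y 2) + b * c * ((r * y 3 - I * s * y 1) * (r * y 3 - I * s * y 1)) =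
      1 * (y 0 * y 0) + e * (y 1 * y 1) + c * (y 2 * y 2) + e * c * (y 3 * y 3)
    rw [h, hDdef]
    linear_combination (b * c ^ 2 * s ^ 2 * y 3 ^ 2 + b * c * s ^ 2 * y 1 ^ 2) * hI

theorem weightedSumSquares_equivalent_pfisterForm {I : K} (hI : I ^ 2 = -1) (a b : Kˣ) :
    (QuadraticMap.weightedSumSquares K ![(1 : K), a, b, a * b]).Equivalent (pfisterForm a b) := by
  have hI0 : I ≠ 0 := by
    rintro rfl; simp at hI
  refine weightedSumSquares_equivalent_of_sq ![1, I, I, 1] ?_ ?_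
  · intro i; fin_cases i
    exacts [one_ne_zero, hI0, hI0, one_ne_zero]
  · intro i; fin_cases i
    · change (1 : K) * 1 ^ 2 = 1; ring
    · change -(a : K) * I ^ 2 = a; rw [hI]; ring
    · change -(b : K) * I ^ 2 = b; rw [hI]; ring
    · change (a * b : K) * 1 ^ 2 = a * b; ring

theorem two_ne_zero_of_primitiveRoot {M : ℕ} (hM : 0 < M) {ζ : K}
    (hζ : IsPrimitiveRoot ζ (4 * M)) : (2 : K) ≠ 0 := by
  have : NeZero (4 * M) := ⟨by omega⟩
  intro h
  refine hζ.neZero'.out ?_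
  rw [show ((4 * M : ℕ) : K) = 2 * (2 * M) by push_cast; ring, h, zero_mul]

/-- For even `k` the number is visibly a square; for odd `k` it is twice a square, and `K` then
contains a primitive eighth root of unity, hence `√2`. -/
theorem exists_sq_eq_natCast {k : ℕ} {ζ : K} (hζ : IsPrimitiveRoot ζ (4 * 2 ^ k)) :
    ∃ r : K, r ≠ 0 ∧ ((16 * 2 ^ k : ℕ) : K) = r ^ 2 := by
  have hI : (ζ ^ 2 ^ k) ^ 2 = -1 := by
    rw [← pow_mul, mul_comm]
    exact primitiveRoot_pow_half (by positivity) (by rwa [← mul_assoc])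
  suffices ∃ r : K, ((16 * 2 ^ k : ℕ) : K) = r ^ 2 by
    obtain ⟨r, hr⟩ := this
    refine ⟨r, ?_, hr⟩
    rintro rfl
    have h3 : (2 : K) ^ (k + 4) = ((16 * 2 ^ k : ℕ) : K) := by push_cast; ring
    rw [hr, zero_pow two_ne_zero] at h3
    exact two_ne_zero_of_primitiveRoot (by positivity) hζ (pow_eq_zero_iff (by omega) |>.1 h3)
  rcases Nat.even_or_odd' k with ⟨j, rfl | rfl⟩
  · exact ⟨4 * 2 ^ j, by push_cast; ring⟩
  -- If `e ^ 2 = I` and `I ^ 2 = -1`, then `(e (1 - I)) ^ 2 = I * (-2 I) = 2`.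
  · have h2 : (ζ ^ 2 ^ (2 * j) * (1 - ζ ^ 2 ^ (2 * j + 1))) ^ 2 = 2 := by
      have : (ζ ^ 2 ^ (2 * j)) ^ 2 = ζ ^ 2 ^ (2 * j + 1) := by rw [← pow_mul, ← pow_succ]
      rw [mul_pow, this]
      linear_combination (-2 + ζ ^ 2 ^ (2 * j + 1)) * hI
    refine ⟨4 * 2 ^ j * (ζ ^ 2 ^ (2 * j) * (1 - ζ ^ 2 ^ (2 * j + 1))), ?_⟩
    rw [mul_pow, h2]; push_cast; ring

end Forms

/-! ### Kummer-type elements of a modular extension. -/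

section Data

variable {K : Type u} {L : Type v} [Field K] [Field L] [Algebra K L]

/-- Dedekind's independence of characters. -/
theorem exists_sum_mul_ne_zero {ι : Type*} [Fintype ι] {g : ι → L ≃ₐ[K] L}
    (hg : Function.Injective g) (a : ι → L) {i : ι} (hi : a i ≠ 0) :
    ∃ x, ∑ i, a i * g i x ≠ 0 := by
  by_contra! h
  have hinj : Function.Injective (fun i => ((g i : L ≃ₐ[K] L) : L →* L)) := by
    intro i j hij
    exact hg (AlgEquiv.ext fun x => DFunLike.congr_fun hij x)
  have hli := (linearIndependent_monoidHom L L).comp _ hinj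
  rw [Fintype.linearIndependent_iff] at hli
  refine hi (hli a ?_ i)
  ext x
  simpa using h x

variable [FiniteDimensional K L] [IsGalois K L]

theorem exists_algebraMap_eq_of_fixed {σ τ : L ≃ₐ[K] L}
    (h : Subgroup.closure {σ, τ} = ⊤) {x : L} (hσ : σ x = x) (hτ : τ x = x) :
    ∃ a : K, algebraMap K L a = x := by
  have hle : Subgroup.closure {σ, τ} ≤ MulAction.stabilizer (L ≃ₐ[K] L) x := by
    rw [Subgroup.closure_le]
    rintro g (rfl | rfl)
    exacts [hσ, hτ]
  rw [h] at hle
  have := (IsGalois.mem_bot_iff_fixed (F := K) x).2 fun g => hle (Subgroup.mem_top g)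
  exact IntermediateField.mem_bot.1 this

-- As `τ ∉ ⟨σ⟩`, it moves some `w` in the fixed field of `σ`. It preserves that field because it
-- normalises `⟨σ⟩`, so `w - τ w` works.
omit [IsGalois K L] in
theorem exists_fixed_neg {N : ℕ} {σ τ : L ≃ₐ[K] L} (h : IsModularPair N σ τ) :
    ∃ β : L, β ≠ 0 ∧ σ β = β ∧ τ β = -β := by
  have hτ : τ ∉ (IntermediateField.fixedField (Subgroup.zpowers σ)).fixingSubgroup := by
    rw [IntermediateField.fixingSubgroup_fixedField]; exact h.notMem
  rw [IntermediateField.mem_fixingSubgroup_iff] at hτ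
  push Not at hτ
  obtain ⟨w, hw, hne⟩ := hτ
  have hz : ∀ k : ℕ, (σ ^ k) w = w := fun k => hw ⟨_, Subgroup.npow_mem_zpowers σ k⟩
  have hττ : τ (τ w) = w := by
    have := DFunLike.congr_fun h.sq_eq w
    rwa [sq] at this
  refine ⟨w - τ w, sub_ne_zero.2 hne.symm, ?_, by rw [map_sub, hττ]; ring⟩
  have h1 : σ (τ w) = τ w := by
    have h3 : τ * σ ^ (1 + N) = σ * τ := by
      have : τ * τ = 1 := by rw [← sq, h.sq_eq]
      rw [← h.conj_eq, mul_assoc τ σ τ, ← mul_assoc, this, one_mul]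
    have := DFunLike.congr_fun h3 w
    simp only [AlgEquiv.mul_apply] at this
    rw [← this, hz]
  have h2 := hz 1
  rw [pow_one] at h2
  rw [map_sub, h1, h2]

-- A Lagrange resolvent for `σ ^ 2`, applied to `x + τ x`. It stays `τ`-invariant since `τ` commutes
-- with `σ ^ 2`, and some `x` makes it nonzero because the `σ ^ (2i) τ ^ j` are distinct.
omit [FiniteDimensional K L] [IsGalois K L] in
theorem exists_kummer_vector {M : ℕ} (hM : 0 < M) {ζ : K} (hζ : IsPrimitiveRoot ζ (4 * M))
    {σ τ : L ≃ₐ[K] L} (h : IsModularPair (4 * M) σ τ) :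
    ∃ v : L, v ≠ 0 ∧ σ (σ v) = algebraMap K L ζ * v ∧ τ v = v := by
  have hζ0 : ζ ≠ 0 := hζ.ne_zero (by omega)
  have hinj : Function.Injective
      (fun p : Fin (4 * M) × Fin 2 => (σ ^ 2) ^ (p.1 : ℕ) * τ ^ (p.2 : ℕ)) := by
    rintro ⟨i, j⟩ ⟨i', j'⟩ he
    dsimp only at he
    rw [← pow_mul, ← pow_mul] at he
    obtain ⟨h1, h2⟩ := h.eq_of_pow_mul_pow_eq (by omega) (by omega) j.2 j'.2 he
    exact Prod.ext (Fin.ext (show (i : ℕ) = i' by omega)) (Fin.ext h2)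
  obtain ⟨x, hx⟩ := exists_sum_mul_ne_zero hinj (fun p => algebraMap K L (ζ⁻¹ ^ (p.1 : ℕ)))
    (i := (⟨0, by omega⟩, 0)) (by simp)
  have hcomm : τ * σ ^ 2 = σ ^ 2 * τ := by
    rw [mul_pow_of_conj h.sq_eq h.conj_eq, show (1 + 4 * M) * 2 = 2 + 2 * (4 * M) by ring, pow_add,
      h.pow_eq_one, mul_one]
  have hττ : ∀ w, τ (τ w) = w := fun w => by
    have := DFunLike.congr_fun h.sq_eq w
    rwa [sq] at this
  let F : ℕ → L := fun i => algebraMap K L (ζ⁻¹ ^ i) * ((σ ^ 2) ^ i) (x + τ x)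
  have hF : ∑ i ∈ Finset.range (4 * M), F i ≠ 0 := by
    convert hx using 1
    rw [Fintype.sum_prod_type, Finset.sum_range]
    refine Finset.sum_congr rfl fun i _ => ?_
    simp only [F, Fin.sum_univ_two, map_add, AlgEquiv.mul_apply, mul_add]
    simp
  have hFN : F (4 * M) = F 0 := by
    simp only [F]
    rw [inv_pow, hζ.pow_eq_one, ← pow_mul, h.pow_eq_one]; simp
  have hFs : ∀ i, (σ ^ 2) (F i) = algebraMap K L ζ * F (i + 1) := by
    intro i
    simp only [F, map_mul, AlgEquiv.commutes]
    rw [pow_succ' (σ ^ 2), AlgEquiv.mul_apply, ← mul_assoc, ← map_mul]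
    congr 2
    rw [pow_succ]; field_simp
  have hFt : ∀ i, τ (F i) = F i := by
    intro i
    have h1 : τ * (σ ^ 2) ^ i = (σ ^ 2) ^ i * τ :=
      (show Commute τ (σ ^ 2) from hcomm).pow_right i
    have h2 := DFunLike.congr_fun h1 (x + τ x)
    simp only [AlgEquiv.mul_apply] at h2
    simp only [F]
    rw [map_mul, AlgEquiv.commutes, h2, map_add τ, hττ, add_comm x]
  refine ⟨_, hF, ?_, ?_⟩
  · have : σ (σ (∑ i ∈ Finset.range (4 * M), F i)) = (σ ^ 2) (∑ i ∈ Finset.range (4 * M), F i) := by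
      rw [sq]; rfl
    rw [this, map_sum, Finset.mul_sum]
    simp only [hFs, ← Finset.mul_sum]
    congr 1
    have h1 := Finset.sum_range_succ F (4 * M)
    rw [Finset.sum_range_succ', hFN] at h1
    exact add_right_cancel h1
  · rw [map_sum]; simp only [hFt]

/-- The last relation is a norm computation: an element `y` of `K(ρ ^ 2) = K(√c)` satisfies `β ^ 2 *
(y * σ y) = ζ`. -/
theorem exists_modular_data {M : ℕ} (hM : 0 < M) {ζ : K} (hζ : IsPrimitiveRoot ζ (4 * M))
    {σ τ : L ≃ₐ[K] L} (h : IsModularPair (4 * M) σ τ) :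
    ∃ (v β ρ : L) (b c r s : K), v ≠ 0 ∧ β ≠ 0 ∧ ρ ≠ 0 ∧ σ (σ v) = algebraMap K L ζ * v ∧
      σ β = β ∧ τ β = -β ∧ τ ρ = ρ ∧ σ ρ = algebraMap K L (ζ ^ M) * ρ ∧
      β ^ 2 = algebraMap K L b ∧ ρ ^ 4 = algebraMap K L c ∧ ζ = b * (r ^ 2 - c * s ^ 2) := by
  have h2 : (2 : L) ≠ 0 := by
    rw [← map_ofNat (algebraMap K L) 2]
    exact (map_ne_zero _).2 (two_ne_zero_of_primitiveRoot hM hζ)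
  have hζ2M : ζ ^ (2 * M) = -1 :=
    primitiveRoot_pow_half (by omega) (by rwa [show 2 * (2 * M) = 4 * M by ring])
  have hζ0 : algebraMap K L ζ ≠ 0 := by simpa using hζ.ne_zero (by omega)
  obtain ⟨v, hv0, hσσv, hτv⟩ := exists_kummer_vector hM hζ h
  obtain ⟨β, hβ0, hσβ, hτβ⟩ := exists_fixed_neg h
  have hconj : ∀ x, τ (σ x) = (σ ^ (1 + 4 * M)) (τ x) := fun x => by
    have := mul_pow_of_conj h.sq_eq h.conj_eq 1
    rw [pow_one, mul_one] at this
    exact DFunLike.congr_fun this x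
  have hpow : ∀ (l : K) (x : L), σ (σ x) = algebraMap K L l * x → ∀ i,
      (σ ^ (1 + 2 * i)) x = algebraMap K L (l ^ i) * σ x := by
    intro l x hx i
    induction i with
    | zero => simp
    | succ i ih =>
      rw [show 1 + 2 * (i + 1) = 1 + 1 + (1 + 2 * i) by ring, pow_add, AlgEquiv.mul_apply, ih,
        map_mul, AlgEquiv.commutes, pow_add, pow_one, AlgEquiv.mul_apply, hx, map_mul,
        AlgEquiv.commutes, ← mul_assoc, ← map_mul, pow_succ]
  -- The twist of the group enters here: `τ σ = σ ^ (1 + 4M) τ`, and `σ ^ (4M)` acts on `σ v` as `ζ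
  -- ^ (2M) = -1`.
  have hτσv : τ (σ v) = -σ v := by
    rw [hconj, hτv, show 4 * M = 2 * (2 * M) by ring, hpow ζ v hσσv, hζ2M]; simp
  have hσv0 : σ v ≠ 0 := by simpa using hv0
  -- The factor `β` cancels the sign by which `τ` acts on `v * σ v`, while `σ` still scales by `ζ`.
  let γ := β * v * σ v
  have hγ0 : γ ≠ 0 := mul_ne_zero (mul_ne_zero hβ0 hv0) hσv0
  have hσγ : σ γ = algebraMap K L ζ * γ := by
    simp only [γ, map_mul, hσβ, hσσv]; ring
  have hτγ : τ γ = γ := by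
    simp only [γ, map_mul, hτβ, hτv, hτσv]; ring
  let ρ := γ ^ M
  have hρ0 : ρ ≠ 0 := pow_ne_zero _ hγ0
  have hσρ : σ ρ = algebraMap K L (ζ ^ M) * ρ := by
    simp only [ρ, map_pow, hσγ, mul_pow]
  have hτρ : τ ρ = ρ := by simp only [ρ, map_pow, hτγ]
  have hσρ2 : σ (ρ ^ 2) = -ρ ^ 2 := by
    rw [map_pow, hσρ, mul_pow, ← map_pow, ← pow_mul, mul_comm M, hζ2M]; simp
  obtain ⟨b, hb⟩ := exists_algebraMap_eq_of_fixed h.closure_eq (x := β ^ 2)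
    (by rw [map_pow, hσβ]) (by rw [map_pow, hτβ]; ring)
  obtain ⟨c, hc⟩ := exists_algebraMap_eq_of_fixed h.closure_eq (x := ρ ^ 4)
    (by rw [show ρ ^ 4 = (ρ ^ 2) ^ 2 by ring, map_pow, hσρ2]; ring) (by rw [map_pow, hτρ])
  -- Fixed by `σ ^ 2` and `τ`, with conjugate `σ y`; `r` and `s` below are its coordinates in the
  -- basis `1, ρ ^ 2`.
  let y := σ v / (v * β)
  have hσy : σ y = algebraMap K L ζ * v / (σ v * β) := by
    simp only [y, map_div₀, map_mul, hσβ, hσσv]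
  have hσσy : σ (σ y) = y := by
    simp only [hσy, map_div₀, map_mul, hσβ, hσσv, AlgEquiv.commutes, y]
    field_simp
  have hτy : τ y = y := by
    simp only [y, map_div₀, map_mul, hτσv, hτv, hτβ]
    field_simp
  have hτσy : τ (σ y) = σ y := by
    rw [hconj, hτy, show 4 * M = 2 * (2 * M) by ring, hpow 1 y (by rw [hσσy]; simp)]; simp
  obtain ⟨r, hr⟩ := exists_algebraMap_eq_of_fixed h.closure_eq (x := (y + σ y) / 2)
    (by rw [map_div₀, map_add, hσσy, map_ofNat, add_comm])
    (by rw [map_div₀, map_add, hτσy, hτy, map_ofNat])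
  obtain ⟨s, hs⟩ := exists_algebraMap_eq_of_fixed h.closure_eq (x := (y - σ y) / (2 * ρ ^ 2))
    (by rw [map_div₀, map_sub, hσσy, map_mul, hσρ2, map_ofNat]; field_simp; ring)
    (by rw [map_div₀, map_sub, hτσy, hτy, map_mul, map_pow, hτρ, map_ofNat])
  refine ⟨v, β, ρ, b, c, r, s, hv0, hβ0, hρ0, hσσv, hσβ, hτβ, hτρ, hσρ, hb.symm, hc.symm, ?_⟩
  apply (algebraMap K L).injective
  rw [map_mul, map_sub, map_mul, map_pow, map_pow, hb, hc, hr, hs]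
  have hyy : β ^ 2 * (y * σ y) = algebraMap K L ζ := by
    rw [hσy]; simp only [y]; field_simp
  rw [← hyy]
  field_simp
  ring

end Data

/-! ### From a modular extension to a Pfister form. -/

section Forward

variable {K : Type u} {L : Type v} [Field K] [Field L] [Algebra K L]

theorem exists_wittEquivalent_pfisterForm [FiniteDimensional K L] [IsGalois K L] {k : ℕ} {ζ : Kˣ}
    (hζ : IsPrimitiveRoot (ζ : K) (4 * 2 ^ k)) {σ τ : L ≃ₐ[K] L}
    (h : IsModularPair (4 * 2 ^ k) σ τ) :
    ∃ a : Kˣ, squareClass a ≠ squareClass 1 ∧ squareClass a ≠ squareClass ζ ∧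
      WittEquivalent (traceQuadraticForm K L) (pfisterForm ζ a) := by
  have hM : 0 < 2 ^ k := by positivity
  obtain ⟨v, β, ρ, b, c, r, s, hv, hβ, hρ, hσv, hσβ, hτβ, hτρ, hσρ, hb, hc, hnorm⟩ :=
    exists_modular_data hM hζ h
  have hdim : Module.finrank K L = 16 * 2 ^ k := by
    rw [← IsGalois.card_aut_eq_finrank, h.natCard_eq (by positivity)]; ring
  obtain ⟨t, ht0, ht⟩ := exists_sq_eq_natCast hζ
  have h2 : (2 : K) ≠ 0 := two_ne_zero_of_primitiveRoot hM hζ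
  have h2L : (2 : L) ≠ 0 := by
    rw [← map_ofNat (algebraMap K L) 2]; exact (map_ne_zero _).2 h2
  have hneg : ∀ x : L, x ≠ 0 → -x ≠ x := fun x hx he => by
    have : 2 * x = 0 := by linear_combination -he
    exact (mul_ne_zero h2L hx) this
  have hI : ((ζ : K) ^ 2 ^ k) ^ 2 = -1 := by
    rw [← pow_mul, mul_comm]
    exact primitiveRoot_pow_half (by positivity) (by rwa [← mul_assoc])
  have hσρ2 : σ (ρ ^ 2) = -ρ ^ 2 := by
    rw [map_pow, hσρ, mul_pow, ← map_pow, hI]; simp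
  have hb0 : b ≠ 0 := by
    rintro rfl; exact ζ.ne_zero (by rw [hnorm]; ring)
  have hc0 : c ≠ 0 := by
    rintro rfl; exact hρ (by simpa using hc)
  -- A nonzero element whose square is a square of `K` lies in `K`, so no automorphism negates it.
  have hsq : ∀ (x : L) (a : K), x ≠ 0 → x ^ 2 = algebraMap K L (a ^ 2) →
      ∀ g : L ≃ₐ[K] L, g x ≠ -x := by
    intro x a hx hxa g hg
    rw [map_pow, sq_eq_sq_iff_eq_or_eq_neg] at hxa
    apply hneg x hx
    rw [← hg]
    rcases hxa with rfl | rfl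
    · exact g.commutes a
    · rw [map_neg, g.commutes]
  have hW := (wittEquivalent_traceForm hM hζ hdim hv hβ hρ hσv hσβ hτβ hτρ hσρ hb hc).trans
    (.of_equivalent (weightedSumSquares_scale_equivalent ht0 ht))
  -- If `c` is in the class of `ζ`, the form is already `⟪ζ, b⟫`, and `b` in that class would make
  -- `bc = (β ρ ^ 2) ^ 2` a square. Otherwise the norm relation replaces `b` by `ζ`.
  by_cases hcz : ∃ z : K, c = ζ * z ^ 2
  · obtain ⟨z, hz⟩ := hcz
    have hz0 : z ≠ 0 := by
      rintro rfl; exact hc0 (by rw [hz]; ring)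
    refine ⟨Units.mk0 b hb0, ?_, ?_, ?_⟩
    · rw [Ne, squareClass_eq_iff]
      rintro ⟨x, hx⟩
      simp only [Units.val_mk0, Units.val_one, one_mul] at hx
      exact hsq β x hβ (by rw [hb, hx]) τ hτβ
    · rw [Ne, squareClass_eq_iff]
      rintro ⟨x, hx⟩
      simp only [Units.val_mk0] at hx
      refine hsq (β * ρ ^ 2) (ζ * x * z) (mul_ne_zero hβ (pow_ne_zero _ hρ)) ?_ τ
        (by rw [map_mul, map_pow, hτβ, hτρ]; ring)
      rw [mul_pow, ← pow_mul, hb, hc, ← map_mul, hx, hz]; congr 1; ring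
    · refine hW.trans (.of_equivalent ((weightedSumSquares_swap_equivalent b c).trans
        (QuadraticMap.Equivalent.trans ?_ (weightedSumSquares_equivalent_pfisterForm hI _ _))))
      refine weightedSumSquares_equivalent_of_sq ![1, z, 1, z] ?_ ?_
      · intro i; fin_cases i
        exacts [one_ne_zero, hz0, one_ne_zero, hz0]
      · intro i; fin_cases i
        · change (1 : K) * 1 ^ 2 = 1; ring
        · exact hz.symm
        · change b * 1 ^ 2 = b; ring
        · change ζ * b * z ^ 2 = c * b; rw [hz]; ring
  · refine ⟨Units.mk0 c hc0, ?_, ?_, ?_⟩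
    · rw [Ne, squareClass_eq_iff]
      rintro ⟨x, hx⟩
      simp only [Units.val_mk0, Units.val_one, one_mul] at hx
      exact hsq (ρ ^ 2) x (pow_ne_zero _ hρ) (by rw [← pow_mul, hc, hx]) σ hσρ2
    · rw [Ne, squareClass_eq_iff]; exact hcz
    · exact hW.trans (.of_equivalent
        ((weightedSumSquares_norm_equivalent hI ζ.ne_zero hnorm).symm.trans
          (weightedSumSquares_equivalent_pfisterForm hI ζ (Units.mk0 c hc0))))

end Forward
end TraceForms

namespace TraceForms

/-! ### Building a modular extension with a prescribed Pfister form. -/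

section Backward

-- The splitting field of `(X ^ 2 - ζ)(X ^ (2N) - a)`. The factors are coprime because `X ^ (2N) -
-- a` is congruent to `ζ ^ N - a = 1 - a` modulo the first.
open Polynomial in
theorem exists_galois_with_radicals {K : Type u} [Field K] {N : ℕ} (hN : 0 < N) {ζ a : K}
    (hζ : IsPrimitiveRoot ζ N) (h2 : (2 : K) ≠ 0) (ha0 : a ≠ 0) (ha1 : a ≠ 1) :
    ∃ (L : Type u) (_ : Field L) (_ : Algebra K L) (_ : FiniteDimensional K L)
      (_ : IsGalois K L) (ω r : L), ω ^ 2 = algebraMap K L ζ ∧ r ^ (2 * N) = algebraMap K L a ∧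
      Algebra.adjoin K {x : L | x ^ 2 = algebraMap K L ζ ∨ x ^ (2 * N) = algebraMap K L a} = ⊤ := by
  have : NeZero N := ⟨by omega⟩
  have hNK : (N : K) ≠ 0 := hζ.neZero'.out
  have hζ0 : ζ ≠ 0 := hζ.ne_zero (by omega)
  let p₁ : K[X] := X ^ 2 - C ζ
  let p₂ : K[X] := X ^ (2 * N) - C a
  have hcop : IsCoprime p₁ p₂ := by
    obtain ⟨q, hq⟩ : p₁ ∣ (X ^ 2) ^ N - (C ζ) ^ N := sub_dvd_pow_sub_pow _ _ _
    refine ⟨-C (1 - a)⁻¹ * q, C (1 - a)⁻¹, ?_⟩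
    have h1 : p₂ = p₁ * q + C (1 - a) := by
      rw [← hq, ← pow_mul, ← C_pow, hζ.pow_eq_one, C_sub]
      ring
    have h3 : C (1 - a)⁻¹ * C (1 - a) = (1 : K[X]) := by
      rw [← C_mul, inv_mul_cancel₀ (sub_ne_zero.2 ha1.symm), C_1]
    rw [h1]
    linear_combination h3
  have hsep : (p₁ * p₂).Separable :=
    (separable_X_pow_sub_C ζ (by exact_mod_cast h2) hζ0).mul
      (separable_X_pow_sub_C a (by push_cast; exact mul_ne_zero h2 hNK) ha0) hcop
  let L := (p₁ * p₂).SplittingField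
  have hp₁ : p₁ ≠ 0 := X_pow_sub_C_ne_zero (by omega) _
  have hp₂ : p₂ ≠ 0 := X_pow_sub_C_ne_zero (by omega) _
  have hne : (p₁ * p₂).map (algebraMap K L) ≠ 0 := Polynomial.map_ne_zero (mul_ne_zero hp₁ hp₂)
  have hspl : ((p₁ * p₂).map (algebraMap K L)).Splits := SplittingField.splits _
  obtain ⟨ω, hω⟩ := (hspl.of_dvd hne
    (Polynomial.map_dvd _ (Dvd.intro _ rfl : p₁ ∣ p₁ * p₂))).exists_eval_eq_zero (by
      rw [degree_map, degree_X_pow_sub_C (by omega)]; exact_mod_cast (by omega : 2 ≠ 0))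
  obtain ⟨r, hr⟩ := (hspl.of_dvd hne
    (Polynomial.map_dvd _ (Dvd.intro_left _ rfl : p₂ ∣ p₁ * p₂))).exists_eval_eq_zero (by
      rw [degree_map, degree_X_pow_sub_C (by omega)]; exact_mod_cast (by omega : 2 * N ≠ 0))
  refine ⟨L, inferInstance, inferInstance, inferInstance,
    IsGalois.of_separable_splitting_field hsep, ω, r, ?_, ?_, ?_⟩
  · simpa [p₁, sub_eq_zero] using hω
  · simpa [p₂, sub_eq_zero] using hr
  · rw [eq_top_iff, ← SplittingField.adjoin_rootSet (p₁ * p₂)]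
    refine Algebra.adjoin_mono fun x hx => ?_
    have h1 : x ^ 2 = algebraMap K L ζ ∨ x ^ (2 * N) = algebraMap K L a := by
      simpa [p₁, p₂, sub_eq_zero] using (mem_rootSet.1 hx).2
    exact h1

variable {K : Type u} {L : Type v} [Field K] [Field L] [Algebra K L]

/-- An automorphism is determined by its values at `ω`, a primitive `2N`-th root of unity, and `r`.
The relation holds since `τ σ τ r = -ω r = ω ^ (1 + N) r`. -/
theorem exists_isModularPair [FiniteDimensional K L] [IsGalois K L] {k : ℕ} {ζ a : Kˣ}
    (hζ : IsPrimitiveRoot (ζ : K) (4 * 2 ^ k))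
    (hK : ¬ ∃ ξ : K, IsPrimitiveRoot ξ (2 * (4 * 2 ^ k)))
    (ha1 : squareClass a ≠ squareClass 1) (haζ : squareClass a ≠ squareClass ζ) {ω r : L}
    (hω : ω ^ 2 = algebraMap K L ζ) (hr : r ^ (2 * (4 * 2 ^ k)) = algebraMap K L a)
    (hgen : Algebra.adjoin K {x : L | x ^ 2 = algebraMap K L ζ ∨
      x ^ (2 * (4 * 2 ^ k)) = algebraMap K L a} = ⊤) :
    ∃ σ τ : L ≃ₐ[K] L, IsModularPair (4 * 2 ^ k) σ τ ∧ σ ω = ω ∧ σ r = ω * r ∧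
      τ ω = -ω ∧ τ r = r := by
  have hM : 0 < 2 ^ k := by positivity
  set N := 4 * 2 ^ k with hN
  have hN0 : 0 < N := by omega
  have : NeZero (2 * N) := ⟨by omega⟩
  have h2 : (2 : L) ≠ 0 := by
    rw [← map_ofNat (algebraMap K L) 2]
    exact (map_ne_zero _).2 (two_ne_zero_of_primitiveRoot hM hζ)
  have hω0 : ω ≠ 0 := by
    rintro rfl
    exact (map_ne_zero (algebraMap K L)).2 ζ.ne_zero (by rw [← hω]; simp)
  have hr0 : r ≠ 0 := by
    rintro rfl
    exact (map_ne_zero (algebraMap K L)).2 a.ne_zero (by rw [← hr]; exact zero_pow (by omega))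
  have hωN : ω ^ N = -1 := by
    rw [show N = 2 * (2 * 2 ^ k) by omega, pow_mul, hω, ← map_pow,
      primitiveRoot_pow_half (by omega) (by rwa [show 2 * (2 * 2 ^ k) = N by omega])]
    simp
  have hneg : ∀ x : L, x ≠ 0 → -x ≠ x := fun x hx he => by
    have : 2 * x = 0 := by linear_combination -he
    exact (mul_ne_zero h2 hx) this
  have hωprim : IsPrimitiveRoot ω (2 * N) := by
    rw [IsPrimitiveRoot.iff_orderOf, show 2 * N = 2 ^ (k + 2 + 1) by rw [hN]; ring]
    apply orderOf_eq_prime_pow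
    · rw [show 2 ^ (k + 2) = N by rw [hN]; ring, hωN]
      exact hneg 1 one_ne_zero
    · rw [show 2 ^ (k + 2 + 1) = N * 2 by rw [hN]; ring, pow_mul, hωN]; ring
  have hgω : ∀ g : L ≃ₐ[K] L, g ω = ω ∨ g ω = -ω := fun g => by
    rw [← sq_eq_sq_iff_eq_or_eq_neg, ← map_pow, hω, g.commutes]
  have hroot : ∀ x : L, x ^ (2 * N) = algebraMap K L a → ∃ i, x = ω ^ i * r := by
    intro x hx
    obtain ⟨i, -, hi⟩ := hωprim.eq_pow_of_pow_eq_one (ξ := x / r) (by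
      rw [div_pow, hx, hr, div_self ((map_ne_zero _).2 a.ne_zero)])
    exact ⟨i, by rw [hi]; field_simp⟩
  have hgr : ∀ g : L ≃ₐ[K] L, ∃ i, g r = ω ^ i * r := fun g =>
    hroot _ (by rw [← map_pow, hr, g.commutes])
  have hext : ∀ g h : L ≃ₐ[K] L, g ω = h ω → g r = h r → g = h := by
    intro g h hgh hgh'
    have : (g : L →ₐ[K] L) = h := by
      apply AlgHom.ext_of_adjoin_eq_top hgen
      rintro x (hx | hx)
      · rw [← hω, sq_eq_sq_iff_eq_or_eq_neg] at hx
        rcases hx with rfl | rfl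
        · exact hgh
        · simpa using hgh
      · obtain ⟨i, rfl⟩ := hroot x hx
        simp [hgh, hgh']
    exact AlgEquiv.ext fun x => DFunLike.congr_fun this x
  have hfix : ∀ x : L, (∀ g : L ≃ₐ[K] L, g x = x) → ∃ b : K, algebraMap K L b = x := fun x hx =>
    IntermediateField.mem_bot.1 ((IsGalois.mem_bot_iff_fixed (F := K) x).2 hx)
  let s := r ^ N
  have hs : s ^ 2 = algebraMap K L a := by rw [← hr, ← pow_mul, mul_comm]
  have hs0 : s ≠ 0 := pow_ne_zero _ hr0
  have hgs : ∀ g : L ≃ₐ[K] L, g s = s ∨ g s = -s := fun g => by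
    rw [← sq_eq_sq_iff_eq_or_eq_neg, ← map_pow, hs, g.commutes]
  obtain ⟨h₀, hh₀⟩ : ∃ h : L ≃ₐ[K] L, h ω = -ω := by
    by_contra! hcon
    obtain ⟨ξ, hξ⟩ := hfix ω fun g => (hgω g).resolve_right (hcon g)
    exact hK ⟨ξ, IsPrimitiveRoot.of_map_of_injective (by rwa [hξ]) (algebraMap K L).injective⟩
  obtain ⟨h₁, hh₁⟩ : ∃ h : L ≃ₐ[K] L, h s = -s := by
    by_contra! hcon
    obtain ⟨z, hz⟩ := hfix s fun g => (hgs g).resolve_right (hcon g)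
    refine ha1 (squareClass_eq_iff.2 ⟨z, (algebraMap K L).injective ?_⟩)
    rw [← hs, ← hz]; simp
  obtain ⟨h₂, hh₂⟩ : ∃ h : L ≃ₐ[K] L, h (s * ω) ≠ s * ω := by
    by_contra! hcon
    obtain ⟨z, hz⟩ := hfix (s * ω) hcon
    refine haζ (squareClass_eq_iff.2 ⟨z * (ζ : K)⁻¹, (algebraMap K L).injective ?_⟩)
    have hζL : algebraMap K L ζ ≠ 0 := (map_ne_zero _).2 ζ.ne_zero
    rw [map_mul, map_pow, map_mul, hz, map_inv₀, ← hs, ← hω]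
    field_simp
  -- Were there none, `h₁` would negate both `ω` and `s`, and `h₂`, which moves `s * ω`, would have
  -- to negate `ω` and fix `s`; but then `h₂ * h₁` is such a `g`.
  obtain ⟨g, hgω', hgs'⟩ : ∃ g : L ≃ₐ[K] L, g ω = ω ∧ g s = -s := by
    by_contra! hcon
    have h1 : h₁ ω = -ω := (hgω h₁).resolve_left fun h => hcon _ h hh₁
    rcases hgω h₂ with h3 | h3
    · have h4 : h₂ s = s := (hgs h₂).resolve_right (hcon _ h3)
      exact hh₂ (by rw [map_mul, h3, h4])
    · rcases hgs h₂ with h4 | h4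
      · exact hcon (h₂ * h₁) (by simp [h1, h3]) (by simp [hh₁, h4])
      · exact hh₂ (by rw [map_mul, h3, h4]; ring)
  obtain ⟨i, hi⟩ := hgr g
  -- `g` multiplies `s = r ^ N` by `ω ^ (iN) = (-1) ^ i`. An odd `i` is invertible modulo the power
  -- of two `2N`, so a power of `g` sends `r` to `ω r`.
  have hodd : Odd i := by
    rw [← Nat.not_even_iff_odd]
    rintro he
    apply hneg s hs0
    rw [← hgs', show g s = (g r) ^ N from map_pow g r N, hi, mul_pow, ← pow_mul, mul_comm i,
      pow_mul, hωN, he.neg_one_pow, one_mul]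
  obtain ⟨m, hm⟩ : ∃ m, ω ^ (i * m) = ω := by
    obtain ⟨m, hm⟩ := Nat.exists_mul_mod_eq_one_of_coprime (k := 2 * N) (n := i) (by
      rw [show 2 * N = 2 ^ (k + 3) by rw [hN]; ring]
      exact Nat.Coprime.pow_right _ hodd.coprime_two_right) (by omega)
    exact ⟨m, by rw [pow_eq_pow_mod _ hωprim.pow_eq_one, hm.2, pow_one]⟩
  have hpow : ∀ (f : L ≃ₐ[K] L) (l : L), f ω = ω → f l = l → f r = l * r →
      ∀ j : ℕ, (f ^ j) ω = ω ∧ (f ^ j) r = l ^ j * r := by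
    intro f l hf hl hfr j
    induction j with
    | zero => simp
    | succ j ih =>
      rw [pow_succ', AlgEquiv.mul_apply, AlgEquiv.mul_apply, ih.1, ih.2, map_mul, map_pow, hl, hfr]
      exact ⟨hf, by ring⟩
  obtain ⟨σ, hσω, hσr⟩ : ∃ σ : L ≃ₐ[K] L, σ ω = ω ∧ σ r = ω * r := by
    have := hpow g (ω ^ i) hgω' (by rw [map_pow, hgω']) hi m
    exact ⟨g ^ m, this.1, by rw [this.2, ← pow_mul, hm]⟩
  have hσ := hpow σ ω hσω hσω hσr
  obtain ⟨τ, hτω, hτr⟩ : ∃ τ : L ≃ₐ[K] L, τ ω = -ω ∧ τ r = r := by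
    obtain ⟨j, hj⟩ := hgr h₀
    have hinv : ∀ x, ((σ ^ j)⁻¹ : L ≃ₐ[K] L) ((σ ^ j) x) = x := fun x => by
      rw [← AlgEquiv.mul_apply, inv_mul_cancel, AlgEquiv.one_apply]
    -- Composing with a power of `σ`, which fixes `ω`, corrects the action on `r`.
    refine ⟨(σ ^ j)⁻¹ * h₀, ?_, ?_⟩
    · rw [AlgEquiv.mul_apply, hh₀, map_neg]
      congr 1
      conv_lhs => rw [← (hσ j).1]
      exact hinv _
    · rw [AlgEquiv.mul_apply, hj, ← (hσ j).2, hinv]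
  refine ⟨σ, τ, ⟨?_, ?_, ?_, ?_, ?_⟩, hσω, hσr, hτω, hτr⟩
  · apply Nat.dvd_antisymm
    · rw [orderOf_dvd_iff_pow_eq_one]
      refine hext _ _ (hσ _).1 ?_
      rw [(hσ _).2, hωprim.pow_eq_one, one_mul]; rfl
    · apply hωprim.dvd_of_pow_eq_one
      have h1 := (hσ (orderOf σ)).2
      rw [pow_orderOf_eq_one, AlgEquiv.one_apply] at h1
      exact mul_right_cancel₀ hr0 (by rw [one_mul]; exact h1.symm)
  · rw [sq]
    exact hext _ _ (by simp [hτω]) (by simp [hτr])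
  · refine hext _ _ ?_ ?_
    · rw [(hσ _).1]; simp [hτω, hσω]
    · rw [(hσ _).2, pow_add, hωN]; simp [hτω, hτr, hσr]
  · intro hmem
    have hle : Subgroup.zpowers σ ≤ MulAction.stabilizer (L ≃ₐ[K] L) ω := by
      rw [Subgroup.zpowers_le]; exact hσω
    have : τ ω = ω := hle hmem
    exact hneg ω hω0 (by rw [← hτω, this])
  · rw [eq_top_iff]
    intro f _
    have hσm : σ ∈ Subgroup.closure {σ, τ} := Subgroup.subset_closure (Or.inl rfl)
    have hτm : τ ∈ Subgroup.closure {σ, τ} := Subgroup.subset_closure (Or.inr rfl)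
    obtain ⟨j, hj⟩ := hgr f
    rcases hgω f with hf | hf
    · rw [hext f (σ ^ j) (by rw [hf, (hσ j).1]) (by rw [hj, (hσ j).2])]
      exact pow_mem hσm _
    · rw [hext f (σ ^ j * τ) (by rw [hf, AlgEquiv.mul_apply, hτω, map_neg, (hσ j).1])
        (by rw [hj, AlgEquiv.mul_apply, hτr, (hσ j).2])]
      exact mul_mem (pow_mem hσm _) hτm

theorem exists_modular_extension {K : Type u} [Field K] {k : ℕ} {ζ a : Kˣ}
    (hζ : IsPrimitiveRoot (ζ : K) (4 * 2 ^ k))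
    (hK : ¬ ∃ ξ : K, IsPrimitiveRoot ξ (2 * (4 * 2 ^ k)))
    (ha1 : squareClass a ≠ squareClass 1) (haζ : squareClass a ≠ squareClass ζ) :
    ∃ (L : Type u) (_ : Field L) (_ : Algebra K L), FiniteDimensional K L ∧ IsGalois K L ∧
      (∃ σ τ : L ≃ₐ[K] L, IsModularPair (4 * 2 ^ k) σ τ) ∧
      WittEquivalent (traceQuadraticForm K L) (pfisterForm ζ a) := by
  have hM : 0 < 2 ^ k := by positivity
  obtain ⟨L, _, _, _, _, ω, r, hω, hr, hgen⟩ := exists_galois_with_radicals (by positivity) hζ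
    (two_ne_zero_of_primitiveRoot hM hζ) a.ne_zero (by
      intro h; exact ha1 (by rw [Units.ext (h.trans Units.val_one.symm)]))
  obtain ⟨σ, τ, h, hσω, hσr, hτω, hτr⟩ := exists_isModularPair hζ hK ha1 haζ hω hr hgen
  refine ⟨L, _, _, inferInstance, inferInstance, ⟨σ, τ, h⟩, ?_⟩
  have hω0 : ω ≠ 0 := by
    rintro rfl
    exact (map_ne_zero (algebraMap K L)).2 ζ.ne_zero (by rw [← hω]; simp)
  have hr0 : r ≠ 0 := by
    rintro rfl
    exact (map_ne_zero (algebraMap K L)).2 a.ne_zero (by rw [← hr]; simp)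
  have hdim : Module.finrank K L = 16 * 2 ^ k := by
    rw [← IsGalois.card_aut_eq_finrank, h.natCard_eq (by positivity)]; ring
  obtain ⟨t, ht0, ht⟩ := exists_sq_eq_natCast hζ
  have hI : ((ζ : K) ^ 2 ^ k) ^ 2 = -1 := by
    rw [← pow_mul, mul_comm]
    exact primitiveRoot_pow_half (by positivity) (by rwa [← mul_assoc])
  -- With these choices `b = ζ` and `c = a` exactly, so no norm argument is needed.
  have hW := wittEquivalent_traceForm (v := r) (β := ω) (ρ := r ^ (2 * 2 ^ k)) (b := ζ) (c := a)
    hM hζ hdim hr0 hω0 (pow_ne_zero _ hr0) (by rw [hσr, map_mul, hσω, hσr, ← hω]; ring) hσω hτω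
    (by rw [map_pow, hτr]) (by rw [map_pow, hσr, mul_pow, pow_mul ω, hω, map_pow]) hω
    (by rw [← hr, ← pow_mul]; congr 1; ring)
  exact hW.trans (.of_equivalent ((weightedSumSquares_scale_equivalent ht0 ht).trans
    (weightedSumSquares_equivalent_pfisterForm hI ζ a)))

end Backward
end TraceForms

/-- The field `L` may be taken in the universe of `K`, being finite over `K`. -/
theorem proposition9p2 {K : Type u} [Field K] (n : ℕ) (hn : 4 ≤ n)
    (ζ : Kˣ) (hζ : IsPrimitiveRoot (ζ : K) (2 ^ (n - 2)))
    (hK : ¬ ∃ ξ : K, IsPrimitiveRoot ξ (2 ^ (n - 1)))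
    {V : Type v} [AddCommGroup V] [Module K V]
    (hV : Module.finrank K V = 2 ^ n)
    (q : QuadraticForm K V) (hq : q.Nondegenerate) :
    (∃ (L : Type u) (_ : Field L) (_ : Algebra K L),
        FiniteDimensional K L ∧ IsGalois K L ∧
        Nonempty (Gal(L/K) ≃* TraceForms.ModularTwoGroup n) ∧
        TraceForms.WittEquivalent q (TraceForms.traceQuadraticForm K L)) ↔
    (∃ a : Kˣ,
        TraceForms.squareClass a ≠ TraceForms.squareClass 1 ∧
        TraceForms.squareClass a ≠ TraceForms.squareClass ζ ∧
        TraceForms.WittEquivalent q (TraceForms.pfisterForm ζ a)) := by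
  obtain ⟨k, rfl⟩ : ∃ k, n = k + 4 := ⟨n - 4, by omega⟩
  have hN : 2 ^ (k + 4 - 2) = 4 * 2 ^ k := by
    rw [show k + 4 - 2 = k + 2 by omega]; ring
  have hN' : 2 ^ (k + 4 - 1) = 2 * (4 * 2 ^ k) := by
    rw [show k + 4 - 1 = k + 3 by omega]; ring
  rw [hN] at hζ
  rw [hN'] at hK
  constructor
  · rintro ⟨L, _, _, _, _, ⟨e⟩, hW⟩
    have h := (TraceForms.isModularPair_of hn).map e.symm
    rw [hN] at h
    obtain ⟨a, ha1, haζ, ha⟩ := TraceForms.exists_wittEquivalent_pfisterForm hζ h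
    exact ⟨a, ha1, haζ, hW.trans ha⟩
  · rintro ⟨a, ha1, haζ, hW⟩
    obtain ⟨L, _, _, hfd, hgal, ⟨σ, τ, h⟩, hL⟩ :=
      TraceForms.exists_modular_extension hζ hK ha1 haζ
    rw [← hN] at h
    exact ⟨L, _, _, hfd, hgal, h.nonempty_mulEquiv hn, hW.trans hL.symm⟩
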